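/- Let $F,\beta:\mathbb R^3\to(0,\infty)$ and $f:\mathbb R^2\to(0,\infty)$ be smooth functions, let $a_3\in\mathbb R$, and put $h_0=F^{-2}(dx^2+dy^2+dz^2)$, $h=\beta^{-2}h_0$ on $\mathbb R^3$ and $\varphi:\mathbb R^2\to\mathbb R^3$, $\varphi(x,y)=(x,y,a_3)$. Then $\varphi:(\mathbb R^2,f^{-1}\varphi^*h)\to(\mathbb R^3,h)$ is a conformal immersion with conformal factor $\lambda=f^{1/2}$, that is, $\varphi^*h=\lambda^2\,(f^{-1}\varphi^*h)$. It is proper biharmonic (its bitension field $$\tau_2(\varphi)=\mathrm{Trace}(\nabla^{\varphi}\nabla^{\varphi}-\nabla^{\varphi}_{\nabla})\tau(\varphi)-\mathrm{Trace}\,R^{h}(d\varphi,\tau(\varphi))d\varphi$$ vanishes identically, where $R^h(X,Y)Z=[\nabla_X,\nabla_Y]Z-\nabla_{[X,Y]}Z$, while its tension field $\tau(\varphi)=\mathrm{Trace}\,\nabla d\varphi$ does not vanish identically; both traces are taken with respect to $f^{-1}\varphi^*h$) if and only if both of the following hold: (1) at every point of the plane $z=a_3$, $$F\beta(F\beta)_{xx}-2((F\beta)_x)^2+F\beta(F\beta)_{yy}-2((F\beta)_y)^2+2F\beta(F\beta)_{zz}-4((F\beta)_z)^2=0;$$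 (2) $(F\beta)_z$ has no zero on the plane $z=a_3$, and there is a constant $c>0$ with $$f=\frac{c}{|(F\beta)_z|}\circ\varphi .$$ Moreover, $\xi=(F\beta)\frac{\partial}{\partial z}$ is a unit normal vector field of the surface $(\mathbb R^2,\varphi^*h)$ in $(\mathbb R^3,h)$, the mean curvature of the surface with respect to $\xi$ is $H=(F\beta)_z\circ\varphi$, and its mean curvature vector (half the trace of the second fundamental form) is $H\xi$. -/

import Mathlib

open scoped ContDiff

/-! Riemannian geometry of maps between coordinate spaces `ℝᵐ = (Fin m → ℝ)`. All objects are given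
by their components in the standard global coordinates. -/

/-- The partial derivative `∂ᵢ f` at `x`. -/
noncomputable def pd {n : ℕ} (i : Fin n) (f : (Fin n → ℝ) → ℝ) (x : Fin n → ℝ) : ℝ :=
  fderiv ℝ f x (Pi.single i 1)

/-- A field of `n × n` matrices on `ℝⁿ`, read as the components `g_{ij}` of a `(0,2)`-tensor. -/
abbrev MetricField (n : ℕ) : Type := (Fin n → ℝ) → Matrix (Fin n) (Fin n) ℝ

/-- `g` is a smooth Riemannian metric on `ℝⁿ`. -/
structure IsRiemannian {n : ℕ} (g : MetricField n) : Prop where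
  smooth : ∀ i j, ContDiff ℝ ∞ (fun x => g x i j)
  posDef : ∀ x, (g x).PosDef

/-- The Euclidean metric. -/
def euclideanMetric (n : ℕ) : MetricField n := fun _ => 1

/-- The inner product `g_x(v, w)`. -/
def metricInner {n : ℕ} (g : MetricField n) (x v w : Fin n → ℝ) : ℝ :=
  ∑ i, ∑ j, g x i j * v i * w j

/-- The Christoffel symbol `Γᵏᵢⱼ` of the Levi-Civita connection of `g`. -/
noncomputable def christoffel {n : ℕ} (g : MetricField n) (k i j : Fin n) (x : Fin n → ℝ) : ℝ :=
  (1 / 2) * ∑ l, (g x)⁻¹ k l *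
    (pd i (fun y => g y j l) x + pd j (fun y => g y i l) x - pd l (fun y => g y i j) x)

/-- The component along `∂_d` of `R(∂_a, ∂_b)∂_c`, for the curvature tensor
`R(X, Y)Z = ∇_X ∇_Y Z - ∇_Y ∇_X Z - ∇_[X,Y] Z` of `g`. -/
noncomputable def curvatureComponent {n : ℕ} (g : MetricField n) (a b c d : Fin n)
    (x : Fin n → ℝ) : ℝ :=
  pd a (christoffel g d b c) x - pd b (christoffel g d a c) x
    + ∑ e, (christoffel g d a e x * christoffel g e b c x
      - christoffel g d b e x * christoffel g e a c x)

/-- `R(X, Y)Z` at the point `x`. -/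
noncomputable def curvature {n : ℕ} (g : MetricField n) (x X Y Z : Fin n → ℝ) : Fin n → ℝ :=
  fun d => ∑ a, ∑ b, ∑ c, curvatureComponent g a b c d x * X a * Y b * Z c

/-- The vector field `dφ(∂ᵢ)` along `φ`. -/
noncomputable def pushBasis {m n : ℕ} (φ : (Fin m → ℝ) → (Fin n → ℝ)) (i : Fin m) :
    (Fin m → ℝ) → (Fin n → ℝ) :=
  fun x a => pd i (fun y => φ y a) x

/-- The pull-back metric `φ^* h`. -/
noncomputable def pullbackMetric {m n : ℕ} (φ : (Fin m → ℝ) → (Fin n → ℝ)) (h : MetricField n) :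
    MetricField m :=
  fun x => Matrix.of fun i j => metricInner h (φ x) (pushBasis φ i x) (pushBasis φ j x)

/-- The covariant derivative `∇^φ_{∂ᵢ} V` of a vector field `V` along `φ`, for the connection on
`φ⁻¹ T ℝⁿ` induced by the Levi-Civita connection of `h`. -/
noncomputable def covDerivAlong {m n : ℕ} (h : MetricField n) (φ : (Fin m → ℝ) → (Fin n → ℝ))
    (i : Fin m) (V : (Fin m → ℝ) → (Fin n → ℝ)) : (Fin m → ℝ) → (Fin n → ℝ) :=
  fun x a => pd i (fun y => V y a) x
    + ∑ b, ∑ c, christoffel h a b c (φ x) * pushBasis φ i x b * V x c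

/-- The second fundamental form of the map, `∇dφ(∂ᵢ, ∂ⱼ) = ∇^φ_{∂ᵢ} dφ(∂ⱼ) - dφ(∇_{∂ᵢ} ∂ⱼ)`. -/
noncomputable def mapHessian {m n : ℕ} (g : MetricField m) (h : MetricField n)
    (φ : (Fin m → ℝ) → (Fin n → ℝ)) (i j : Fin m) (x : Fin m → ℝ) : Fin n → ℝ :=
  covDerivAlong h φ i (pushBasis φ j) x - ∑ k, christoffel g k i j x • pushBasis φ k x

/-- The tension field `τ(φ) = Tr_g ∇dφ` of `φ : (ℝᵐ, g) → (ℝⁿ, h)`. -/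
noncomputable def tension {m n : ℕ} (g : MetricField m) (h : MetricField n)
    (φ : (Fin m → ℝ) → (Fin n → ℝ)) (x : Fin m → ℝ) : Fin n → ℝ :=
  ∑ i, ∑ j, (g x)⁻¹ i j • mapHessian g h φ i j x

/-- The bitension field
`τ₂(φ) = Tr_g (∇^φ ∇^φ - ∇^φ_{∇}) τ(φ) - Tr_g R(dφ, τ(φ)) dφ` of `φ : (ℝᵐ, g) → (ℝⁿ, h)`. -/
noncomputable def bitension {m n : ℕ} (g : MetricField m) (h : MetricField n)
    (φ : (Fin m → ℝ) → (Fin n → ℝ)) (x : Fin m → ℝ) : Fin n → ℝ :=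
  ∑ i, ∑ j, (g x)⁻¹ i j •
    (covDerivAlong h φ i (covDerivAlong h φ j (tension g h φ)) x
      - ∑ k, christoffel g k i j x • covDerivAlong h φ k (tension g h φ) x
      - curvature h (φ x) (pushBasis φ i x) (tension g h φ x) (pushBasis φ j x))

/-- `φ : (ℝᵐ, g) → (ℝⁿ, h)` is a harmonic map. -/
def IsHarmonicMap {m n : ℕ} (g : MetricField m) (h : MetricField n)
    (φ : (Fin m → ℝ) → (Fin n → ℝ)) : Prop :=
  ContDiff ℝ ∞ φ ∧ ∀ x, tension g h φ x = 0

/-- `φ : (ℝᵐ, g) → (ℝⁿ, h)` is a biharmonic map. -/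
def IsBiharmonicMap {m n : ℕ} (g : MetricField m) (h : MetricField n)
    (φ : (Fin m → ℝ) → (Fin n → ℝ)) : Prop :=
  ContDiff ℝ ∞ φ ∧ ∀ x, bitension g h φ x = 0

/-- A proper biharmonic map is a biharmonic map that is not harmonic. -/
def IsProperBiharmonicMap {m n : ℕ} (g : MetricField m) (h : MetricField n)
    (φ : (Fin m → ℝ) → (Fin n → ℝ)) : Prop :=
  IsBiharmonicMap g h φ ∧ ¬ IsHarmonicMap g h φ

/-- `φ : (ℝᵐ, g) → (ℝⁿ, h)` is a conformal immersion between Riemannian manifolds with conformal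
factor `lam`, that is, `φ^* h = lam² g`. -/
structure IsConformalImmersion {m n : ℕ} (g : MetricField m) (h : MetricField n)
    (φ : (Fin m → ℝ) → (Fin n → ℝ)) (lam : (Fin m → ℝ) → ℝ) : Prop where
  riemannian_source : IsRiemannian g
  riemannian_target : IsRiemannian h
  smooth : ContDiff ℝ ∞ φ
  immersion : ∀ x, Function.Injective (fderiv ℝ φ x)
  factor_pos : ∀ x, 0 < lam x
  conformal : ∀ x, pullbackMetric φ h x = lam x ^ 2 • g x

/-- `ξ` is a unit normal vector field along `φ` in `(ℝⁿ, h)`. -/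
structure IsUnitNormal {m n : ℕ} (h : MetricField n) (φ ξ : (Fin m → ℝ) → (Fin n → ℝ)) : Prop where
  smooth : ContDiff ℝ ∞ ξ
  normal : ∀ x i, metricInner h (φ x) (ξ x) (pushBasis φ i x) = 0
  unit : ∀ x, metricInner h (φ x) (ξ x) (ξ x) = 1

/-- The mean curvature vector `η = (1/m) Tr_g B` of the immersed submanifold `φ(ℝᵐ)` of `(ℝⁿ, h)`,
where `g = φ^* h` is the induced metric and `B` is the second fundamental form. -/
noncomputable def meanCurvatureVector {m n : ℕ} (h : MetricField n)
    (φ : (Fin m → ℝ) → (Fin n → ℝ)) (x : Fin m → ℝ) : Fin n → ℝ :=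
  (1 / (m : ℝ)) • ∑ i, ∑ j,
    (pullbackMetric φ h x)⁻¹ i j • mapHessian (pullbackMetric φ h) h φ i j x

/-- The mean curvature `H = h(η, ξ)` with respect to the unit normal field `ξ`. -/
noncomputable def meanCurvature {m n : ℕ} (h : MetricField n)
    (φ ξ : (Fin m → ℝ) → (Fin n → ℝ)) (x : Fin m → ℝ) : ℝ :=
  metricInner h (φ x) (meanCurvatureVector h φ x) (ξ x)

/-- The rescaled metric `ρ⁻² g`. -/
noncomputable def rescaleMetric {n : ℕ} (ρ : (Fin n → ℝ) → ℝ) (g : MetricField n) :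
    MetricField n :=
  fun x => (ρ x ^ 2)⁻¹ • g x

/-- The map `(x, y) ↦ (x, y, a)` from `ℝ²` to `ℝ³`. -/
def planeMap (a : ℝ) (p : Fin 2 → ℝ) : Fin 3 → ℝ := ![p 0, p 1, a]

open scoped ContDiff

/-! ### Calculus of partial derivatives. -/

section PartialDerivatives

variable {n : ℕ} {f g : (Fin n → ℝ) → ℝ} {x : Fin n → ℝ}

/-! Put `u = Fβ`. Both metrics are conformally flat: the target is `u⁻² δ` and the source is `ρ⁻² δ`
with `ρ² = f u²`. In dimension two the trace of the source Christoffel symbols vanishes, so the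
source metric enters each trace only through the factor `ρ²`. Hence the tension field is `S ξ`, with
`ξ = u ∂_z` the unit normal and `S = 2 f u_z`.

In the bitension field the mixed derivatives `u_xz`, `u_yz` from the shape operator cancel those
from the curvature (`bitension_planeMap`). Up to `ρ²`, the tangential part is `-2 u_z (S_x, S_y)`
and the normal part is `u ΔS + (S/u) P`, where `P` is the expression in condition (1).

Vanishing of the tangential part, multiplied by `2f`, makes `S²` constant. If the map is not
harmonic, `S` has no zero, so `S` has zero gradient, `f |u_z|` is constant and positive, and the
normal part reduces to `P = 0`. Conversely, `f |u_z| = c` makes `S² = 4c²`, so `S` has zero gradient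
and `P = 0` suffices. -/

theorem pd_const (i : Fin n) (c : ℝ) : pd i (fun _ => c) = fun _ => 0 := by
  funext x
  simp [pd]

theorem pd_neg (i : Fin n) : pd i (fun y => -f y) x = -pd i f x := by
  simp [pd, fderiv_fun_neg]

theorem pd_mul (i : Fin n) (hf : DifferentiableAt ℝ f x) (hg : DifferentiableAt ℝ g x) :
    pd i (fun y => f y * g y) x = pd i f x * g x + f x * pd i g x := by
  simp [pd, fderiv_fun_mul hf hg]
  ring

theorem pd_inv (i : Fin n) (hf : DifferentiableAt ℝ f x) (h0 : f x ≠ 0) :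
    pd i (fun y => (f y)⁻¹) x = -pd i f x / f x ^ 2 := by
  have h := ((hasDerivAt_inv h0).comp_hasFDerivAt x hf.hasFDerivAt).fderiv
  simp only [Function.comp_def] at h
  simp only [pd, h]
  simp
  ring

theorem pd_div (i : Fin n) (hf : DifferentiableAt ℝ f x) (hg : DifferentiableAt ℝ g x)
    (h0 : g x ≠ 0) :
    pd i (fun y => f y / g y) x = pd i f x / g x - f x * pd i g x / g x ^ 2 := by
  simp only [div_eq_mul_inv (f _)]
  rw [pd_mul (g := fun y => (g y)⁻¹) i hf (hg.inv h0), pd_inv i hg h0]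
  ring

theorem contDiff_pd (i : Fin n) (hf : ContDiff ℝ ∞ f) : ContDiff ℝ ∞ (pd i f) :=
  (hf.fderiv_right (m := ∞) (by simp)).clm_apply contDiff_const

theorem pd_comm (hf : ContDiff ℝ ∞ f) (i j : Fin n) : pd i (pd j f) x = pd j (pd i f) x := by
  have hd : DifferentiableAt ℝ (fderiv ℝ f) x :=
    (hf.fderiv_right (m := ∞) (by simp)).differentiable (by simp) x
  have key : ∀ a b : Fin n, pd a (pd b f) x =
      fderiv ℝ (fderiv ℝ f) x (Pi.single a 1) (Pi.single b 1) := by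
    intro a b
    have := fderiv_clm_apply hd (differentiableAt_const (Pi.single b (1 : ℝ) : Fin n → ℝ))
    change fderiv ℝ (fun y => fderiv ℝ f y (Pi.single b 1)) x (Pi.single a 1) = _
    rw [this]
    simp
  rw [key, key]
  exact (hf.contDiffAt.isSymmSndFDerivAt (by
    rw [minSmoothness_of_isRCLikeNormedField]
    exact WithTop.coe_le_coe.2 (le_top (a := (2 : ℕ∞))))).eq _ _

/-- A differentiable function all of whose partial derivatives vanish is constant. -/
theorem eq_of_pd_eq_zero (hf : Differentiable ℝ f) (h : ∀ i x, pd i f x = 0) (x y : Fin n → ℝ) :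
    f x = f y := by
  refine is_const_of_fderiv_eq_zero hf (fun z => ?_) x y
  refine ContinuousLinearMap.coe_injective ((Pi.basisFun ℝ (Fin n)).ext fun i => ?_)
  simpa [pd] using h i z

end PartialDerivatives

/-! ### The embedding of the plane. -/

section Plane

variable {G : (Fin 3 → ℝ) → ℝ} {a : ℝ}

theorem contDiff_planeMap (a : ℝ) : ContDiff ℝ ∞ (planeMap a) := by
  rw [contDiff_pi]
  intro i
  fin_cases i <;> simp [planeMap] <;> fun_prop

theorem pd_planeMap (a : ℝ) (i : Fin 2) (k : Fin 3) (x : Fin 2 → ℝ) :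
    pd i (fun p => planeMap a p k) x = if k = i.castSucc then 1 else 0 := by
  have hp : ∀ j : Fin 2, pd i (fun p : Fin 2 → ℝ => p j) x = if j = i then 1 else 0 := by
    intro j
    have : fderiv ℝ (fun p : Fin 2 → ℝ => p j) x = ContinuousLinearMap.proj j :=
      (ContinuousLinearMap.proj (R := ℝ) (φ := fun _ : Fin 2 => ℝ) j).fderiv
    simp [pd, this, Pi.single_apply]
  fin_cases k
  · have := hp 0
    fin_cases i <;> simpa [planeMap] using this
  · have := hp 1
    fin_cases i <;> simpa [planeMap] using this
  · fin_cases i <;> simp [planeMap, pd_const]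

theorem pushBasis_planeMap (a : ℝ) (i : Fin 2) (x : Fin 2 → ℝ) :
    pushBasis (planeMap a) i x = Pi.single i.castSucc 1 := by
  funext k
  simp [pushBasis, pd_planeMap, Pi.single_apply]

theorem fderiv_planeMap_single (a : ℝ) (i : Fin 2) (x : Fin 2 → ℝ) :
    fderiv ℝ (planeMap a) x (Pi.single i 1) = Pi.single i.castSucc 1 := by
  rw [← pushBasis_planeMap a i x]
  funext k
  have hd := ((contDiff_planeMap a).differentiable (by simp)) x
  rw [pushBasis, pd, fderiv_apply hd k]
  rfl

theorem fderiv_planeMap_apply (a : ℝ) (x v : Fin 2 → ℝ) :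
    fderiv ℝ (planeMap a) x v = ![v 0, v 1, 0] := by
  have hv : v = v 0 • Pi.single 0 1 + v 1 • Pi.single 1 1 := by
    funext i; fin_cases i <;> simp
  conv_lhs => rw [hv]
  rw [map_add, map_smul, map_smul, fderiv_planeMap_single, fderiv_planeMap_single]
  funext k
  fin_cases k <;> simp

theorem pd_comp_planeMap (hG : Differentiable ℝ G) (i : Fin 2) (x : Fin 2 → ℝ) :
    pd i (fun p => G (planeMap a p)) x = pd i.castSucc G (planeMap a x) := by
  have := fderiv_comp x (hG (planeMap a x)) (((contDiff_planeMap a).differentiable (by simp)) x)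
  simp only [Function.comp_def] at this
  rw [pd, this, ContinuousLinearMap.comp_apply, fderiv_planeMap_single]
  rfl

end Plane

/-! ### Conformally flat metrics. -/

section ConformallyFlat

variable {n : ℕ} {u : (Fin n → ℝ) → ℝ}

theorem rescaleMetric_euclidean_apply (u : (Fin n → ℝ) → ℝ) (x : Fin n → ℝ) (i j : Fin n) :
    rescaleMetric u (euclideanMetric n) x i j = if i = j then (u x ^ 2)⁻¹ else 0 := by
  simp [rescaleMetric, euclideanMetric, Matrix.one_apply]

theorem rescaleMetric_euclidean_inv {x : Fin n → ℝ} (h0 : u x ≠ 0) (i j : Fin n) :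
    (rescaleMetric u (euclideanMetric n) x)⁻¹ i j = if i = j then u x ^ 2 else 0 := by
  have : (rescaleMetric u (euclideanMetric n) x)⁻¹ = (u x ^ 2) • 1 := by
    refine Matrix.inv_eq_left_inv ?_
    simp [rescaleMetric, euclideanMetric, smul_smul, h0]
  simp [this, Matrix.one_apply]

theorem isRiemannian_rescaleMetric_euclidean (hu : ContDiff ℝ ∞ u) (h0 : ∀ x, 0 < u x) :
    IsRiemannian (rescaleMetric u (euclideanMetric n)) where
  smooth i j := by
    simp only [rescaleMetric_euclidean_apply]
    split_ifs
    · exact (hu.pow 2).inv fun x => (pow_pos (h0 x) 2).ne'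
    · exact contDiff_const
  posDef x := Matrix.PosDef.one.smul (inv_pos.2 (pow_pos (h0 x) 2))

theorem metricInner_rescaleMetric_euclidean (u : (Fin n → ℝ) → ℝ) (x v w : Fin n → ℝ) :
    metricInner (rescaleMetric u (euclideanMetric n)) x v w = (u x ^ 2)⁻¹ * ∑ i, v i * w i := by
  simp [metricInner, rescaleMetric_euclidean_apply, Finset.mul_sum, mul_assoc]

theorem pd_rescaleMetric_euclidean (hu : Differentiable ℝ u) (h0 : ∀ x, u x ≠ 0)
    (l i j : Fin n) (x : Fin n → ℝ) :
    pd l (fun y => rescaleMetric u (euclideanMetric n) y i j) x =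
      if i = j then -2 * pd l u x / u x ^ 3 else 0 := by
  simp only [rescaleMetric_euclidean_apply]
  split_ifs
  · have hs : (fun y => (u y ^ 2)⁻¹) = fun y => (u y * u y)⁻¹ := by simp only [sq]
    have hd : DifferentiableAt ℝ (fun y => u y * u y) x := (hu x).mul (hu x)
    rw [hs, pd_inv l hd (mul_ne_zero (h0 x) (h0 x)), pd_mul l (hu x) (hu x)]
    have := h0 x
    field_simp
    ring
  · simp [pd_const]

/-- The Christoffel symbols of the conformally flat metric `u⁻² δ`. -/
theorem christoffel_rescaleMetric_euclidean (hu : Differentiable ℝ u) (h0 : ∀ x, u x ≠ 0)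
    (k i j : Fin n) :
    christoffel (rescaleMetric u (euclideanMetric n)) k i j = fun x =>
      ((if i = j then pd k u x else 0) - (if k = i then pd j u x else 0)
        - (if k = j then pd i u x else 0)) / u x := by
  funext x
  have := h0 x
  have hc : ∀ l, (k = l) = (l = k) := fun l => propext eq_comm
  simp only [christoffel, rescaleMetric_euclidean_inv (h0 x), pd_rescaleMetric_euclidean hu h0,
    ite_mul, zero_mul, Finset.sum_ite_eq, Finset.mem_univ, if_true, hc i, hc j]
  split_ifs <;> field_simp <;> ring

theorem rescaleMetric_rescaleMetric (β F : (Fin n → ℝ) → ℝ) (g : MetricField n) :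
    rescaleMetric β (rescaleMetric F g) = rescaleMetric (fun q => F q * β q) g := by
  funext x
  simp [rescaleMetric, smul_smul, mul_pow]

end ConformallyFlat

/-! ### Tension and curvature along the plane. -/

section PlaneInConformallyFlat

variable {u : (Fin 3 → ℝ) → ℝ} {ρ : (Fin 2 → ℝ) → ℝ} {a : ℝ}

theorem pullbackMetric_planeMap (u : (Fin 3 → ℝ) → ℝ) (a : ℝ) :
    pullbackMetric (planeMap a) (rescaleMetric u (euclideanMetric 3)) =
      rescaleMetric (fun p => u (planeMap a p)) (euclideanMetric 2) := by
  funext x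
  ext i j
  simp only [pullbackMetric, Matrix.of_apply, metricInner_rescaleMetric_euclidean,
    pushBasis_planeMap, rescaleMetric_euclidean_apply]
  fin_cases i <;> fin_cases j <;> simp [Pi.single_apply]

/-- The covariant derivative along the plane `z = a` for the metric `u⁻² δ`. -/
theorem covDerivAlong_planeMap (hu : Differentiable ℝ u) (h0 : ∀ x, u x ≠ 0)
    (i : Fin 2) (V : (Fin 2 → ℝ) → (Fin 3 → ℝ)) (x : Fin 2 → ℝ) (k : Fin 3) :
    covDerivAlong (rescaleMetric u (euclideanMetric 3)) (planeMap a) i V x k =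
      pd i (fun y => V y k) x
        + (V x i.castSucc * pd k u (planeMap a x)
          - (if k = i.castSucc then ∑ c, pd c u (planeMap a x) * V x c else 0)
          - pd i.castSucc u (planeMap a x) * V x k) / u (planeMap a x) := by
  simp only [covDerivAlong, pushBasis_planeMap, christoffel_rescaleMetric_euclidean hu h0,
    Fin.sum_univ_three]
  fin_cases i <;> fin_cases k <;> simp <;> ring

/-- Special to dimension two: the coordinates are harmonic for any conformal metric, so the `∇_{∂ᵢ}
∂ᵢ` terms drop out of every trace. -/
theorem sum_christoffel_rescaleMetric_euclidean_two (hρ : Differentiable ℝ ρ)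
    (hρ0 : ∀ x, ρ x ≠ 0) (k : Fin 2) (x : Fin 2 → ℝ) :
    christoffel (rescaleMetric ρ (euclideanMetric 2)) k 1 1 x =
      -christoffel (rescaleMetric ρ (euclideanMetric 2)) k 0 0 x := by
  simp only [christoffel_rescaleMetric_euclidean hρ hρ0]
  fin_cases k <;> simp <;> ring

/-- The tension field of the plane `z = a` for a conformal metric `ρ⁻² δ` on the source. -/
theorem tension_planeMap (hu : Differentiable ℝ u) (h0 : ∀ x, u x ≠ 0)
    (hρ : Differentiable ℝ ρ) (hρ0 : ∀ x, ρ x ≠ 0) (x : Fin 2 → ℝ) :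
    tension (rescaleMetric ρ (euclideanMetric 2)) (rescaleMetric u (euclideanMetric 3))
      (planeMap a) x =
      ![0, 0, 2 * ρ x ^ 2 * pd 2 u (planeMap a x) / u (planeMap a x)] := by
  funext k
  simp only [tension, rescaleMetric_euclidean_inv (hρ0 x), Fin.sum_univ_two, mapHessian,
    Pi.add_apply, Pi.sub_apply, Pi.smul_apply, smul_eq_mul,
    covDerivAlong_planeMap hu h0, pushBasis_planeMap,
    sum_christoffel_rescaleMetric_euclidean_two hρ hρ0, pd_const]
  fin_cases k <;> simp [Pi.single_apply] <;> ring

theorem curvature_single (g : MetricField 3) (x : Fin 3 → ℝ) (i : Fin 3) (t : ℝ) (d : Fin 3) :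
    curvature g x (Pi.single i 1) ![0, 0, t] (Pi.single i 1) d =
      curvatureComponent g i 2 i d x * t := by
  simp only [curvature, Fin.sum_univ_three]
  fin_cases i <;> simp

theorem pd_smooth_div {n : ℕ} {f g : (Fin n → ℝ) → ℝ} (i : Fin n) (hf : ContDiff ℝ ∞ f)
    (hg : ContDiff ℝ ∞ g) (h0 : ∀ x, g x ≠ 0) (x : Fin n → ℝ) :
    pd i (fun y => f y / g y) x = pd i f x / g x - f x * pd i g x / g x ^ 2 :=
  pd_div i (hf.differentiable (by simp) x) (hg.differentiable (by simp) x) (h0 x)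

/-- As `R(∂_z, ∂_z) = 0`, the two horizontal terms already form the full trace, so the value is
minus the Ricci components `Ric(∂_d, ∂_z)` of `u⁻² δ`. -/
theorem curvature_sum (hu : ContDiff ℝ ∞ u) (h0 : ∀ x, u x ≠ 0) (x : Fin 3 → ℝ) (d : Fin 3) :
    curvatureComponent (rescaleMetric u (euclideanMetric 3)) 0 2 0 d x
      + curvatureComponent (rescaleMetric u (euclideanMetric 3)) 1 2 1 d x =
    -(![pd 0 (pd 2 u) x / u x, pd 1 (pd 2 u) x / u x,
      (u x * (pd 0 (pd 0 u) x + pd 1 (pd 1 u) x + 2 * pd 2 (pd 2 u) x)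
        - 2 * (pd 0 u x ^ 2 + pd 1 u x ^ 2 + pd 2 u x ^ 2)) / u x ^ 2] : Fin 3 → ℝ) d := by
  have hd : Differentiable ℝ u := hu.differentiable (by simp)
  have hneg : ∀ k, ContDiff ℝ ∞ fun y => -pd k u y := fun k => (contDiff_pd k hu).neg
  have hx := h0 x
  have c20 := pd_comm (x := x) hu 2 0
  have c21 := pd_comm (x := x) hu 2 1
  simp only [curvatureComponent, christoffel_rescaleMetric_euclidean hd h0, Fin.sum_univ_three]
  fin_cases d <;>
    simp [pd_smooth_div _ (contDiff_pd _ hu) hu h0, pd_smooth_div _ (hneg _) hu h0, pd_neg,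
      pd_const, c20, c21] <;> field_simp <;> ring

end PlaneInConformallyFlat

/-! ### The bitension field of the plane. -/

section Bitension

variable {u : (Fin 3 → ℝ) → ℝ} {ρ S : (Fin 2 → ℝ) → ℝ} {a : ℝ}

/-- Weingarten's formula: `u ∂_z` is parallel in the normal bundle, and the plane is umbilical with
shape operator `u_z`. -/
theorem covDerivAlong_planeMap_normal (hu : Differentiable ℝ u) (h0 : ∀ x, u x ≠ 0)
    (hS : Differentiable ℝ S) (i : Fin 2) :
    covDerivAlong (rescaleMetric u (euclideanMetric 3)) (planeMap a) i
      (fun x => ![0, 0, S x * u (planeMap a x)]) = fun x k =>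
        if k = 2 then pd i S x * u (planeMap a x)
        else if k = i.castSucc then -(S x * pd 2 u (planeMap a x)) else 0 := by
  have hc : Differentiable ℝ fun x => u (planeMap a x) :=
    hu.comp ((contDiff_planeMap a).differentiable (by simp))
  funext x k
  have hx := h0 (planeMap a x)
  rw [covDerivAlong_planeMap hu h0]
  fin_cases i <;> fin_cases k <;>
    simp [pd_const, Fin.sum_univ_three, pd_mul _ (hS x) (hc x), pd_comp_planeMap hu] <;>
    field_simp <;> ring

/-- The bitension field of the plane `z = a` whose tension field is `S • (u ∂_z)`. -/
theorem bitension_planeMap (hu : ContDiff ℝ ∞ u) (h0 : ∀ x, u x ≠ 0)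
    (hρ : Differentiable ℝ ρ) (hρ0 : ∀ x, ρ x ≠ 0) (hS : ContDiff ℝ ∞ S)
    (hτ : tension (rescaleMetric ρ (euclideanMetric 2)) (rescaleMetric u (euclideanMetric 3))
      (planeMap a) = fun x => ![0, 0, S x * u (planeMap a x)]) (x : Fin 2 → ℝ) :
    bitension (rescaleMetric ρ (euclideanMetric 2)) (rescaleMetric u (euclideanMetric 3))
      (planeMap a) x = (ρ x ^ 2) •
      let q := planeMap a x
      ![-2 * pd 0 S x * pd 2 u q, -2 * pd 1 S x * pd 2 u q,
        u q * (pd 0 (pd 0 S) x + pd 1 (pd 1 S) x)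
          + S x / u q * (u q * pd 0 (pd 0 u) q - 2 * (pd 0 u q) ^ 2
          + u q * pd 1 (pd 1 u) q - 2 * (pd 1 u q) ^ 2
          + 2 * u q * pd 2 (pd 2 u) q - 4 * (pd 2 u q) ^ 2)] := by
  have hd : Differentiable ℝ u := hu.differentiable (by simp)
  have hdS : Differentiable ℝ S := hS.differentiable (by simp)
  have hφ : Differentiable ℝ (planeMap a) := (contDiff_planeMap a).differentiable (by simp)
  have hc : Differentiable ℝ fun x => u (planeMap a x) := hd.comp hφ
  have hdz : Differentiable ℝ (pd 2 u) := (contDiff_pd 2 hu).differentiable (by simp)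
  have hcz : Differentiable ℝ fun x => pd 2 u (planeMap a x) := hdz.comp hφ
  have hdSi : ∀ i, Differentiable ℝ (pd i S) := fun i =>
    (contDiff_pd i hS).differentiable (by simp)
  have hx := h0 (planeMap a x)
  funext k
  have hR := curvature_sum hu h0 (planeMap a x) k
  -- Solved for the second curvature term; after substitution the first one cancels.
  rw [← eq_sub_iff_add_eq'] at hR
  simp only [bitension, hτ, rescaleMetric_euclidean_inv (hρ0 x), Fin.sum_univ_two,
    covDerivAlong_planeMap_normal hd h0 hdS, covDerivAlong_planeMap hd h0,
    pushBasis_planeMap, Pi.add_apply, Pi.sub_apply, Pi.smul_apply, smul_eq_mul,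
    sum_christoffel_rescaleMetric_euclidean_two hρ hρ0, Fin.castSucc_zero, Fin.castSucc_one]
  rw [curvature_single, curvature_single, hR]
  fin_cases k <;>
    simp [pd_const, pd_neg, Fin.sum_univ_three, pd_mul _ (hdS x) (hcz x),
      pd_mul _ (hdSi _ x) (hc x), pd_comp_planeMap hd, pd_comp_planeMap hdz] <;>
    field_simp <;> ring

end Bitension

/-! ### The characterization. -/

theorem mainTheorem11 (F β : (Fin 3 → ℝ) → ℝ) (f : (Fin 2 → ℝ) → ℝ) (a₃ : ℝ)
    (hF : ContDiff ℝ ∞ F) (hF_pos : ∀ q, 0 < F q)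
    (hβ : ContDiff ℝ ∞ β) (hβ_pos : ∀ q, 0 < β q)
    (hf : ContDiff ℝ ∞ f) (hf_pos : ∀ p, 0 < f p)
    (h₀ h : MetricField 3) (gbar : MetricField 2) (u : (Fin 3 → ℝ) → ℝ)
    (φ : (Fin 2 → ℝ) → (Fin 3 → ℝ))
    (hh₀ : h₀ = rescaleMetric F (euclideanMetric 3))
    (hh : h = rescaleMetric β h₀)
    (hφ : φ = planeMap a₃)
    (hgbar : gbar = fun p => (f p)⁻¹ • pullbackMetric φ h p)
    (hu : u = fun q => F q * β q) :
    -- the immersion is conformal with conformal factor `√f`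
    IsConformalImmersion gbar h φ (fun p => Real.sqrt (f p)) ∧
    -- the characterization of proper biharmonicity
    (IsProperBiharmonicMap gbar h φ ↔
      (∀ q : Fin 3 → ℝ, q 2 = a₃ →
        u q * pd 0 (pd 0 u) q - 2 * (pd 0 u q) ^ 2
          + u q * pd 1 (pd 1 u) q - 2 * (pd 1 u q) ^ 2
          + 2 * u q * pd 2 (pd 2 u) q - 4 * (pd 2 u q) ^ 2 = 0) ∧
      ∃ c : ℝ, 0 < c ∧ ∀ p, pd 2 u (φ p) ≠ 0 ∧ f p = c / |pd 2 u (φ p)|) ∧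
    -- the mean curvature of the surface with respect to the unit normal field `Fβ ∂/∂z`
    IsUnitNormal h φ (fun p => u (φ p) • Pi.single 2 1) ∧
    (∀ p, meanCurvature h φ (fun p => u (φ p) • Pi.single 2 1) p = pd 2 u (φ p)) ∧
    (∀ p, meanCurvatureVector h φ p = pd 2 u (φ p) • u (φ p) • Pi.single 2 1) := by
  have hupos : ∀ q, 0 < u q := fun q => by rw [hu]; exact mul_pos (hF_pos q) (hβ_pos q)
  have hu0 : ∀ q, u q ≠ 0 := fun q => (hupos q).ne'
  have husm : ContDiff ℝ ∞ u := by rw [hu]; exact hF.mul hβ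
  have hud : Differentiable ℝ u := husm.differentiable (by simp)
  have hh' : h = rescaleMetric u (euclideanMetric 3) := by
    rw [hh, hh₀, hu, rescaleMetric_rescaleMetric]
  clear hh hh₀ hu hF hβ hF_pos hβ_pos
  subst hφ hh'
  set v : (Fin 2 → ℝ) → ℝ := fun p => u (planeMap a₃ p) with hv
  have hvsm : ContDiff ℝ ∞ v := husm.comp (contDiff_planeMap a₃)
  have hvd : Differentiable ℝ v := hvsm.differentiable (by simp)
  have hv0 : ∀ p, v p ≠ 0 := fun p => hu0 _
  have hpull := pullbackMetric_planeMap u a₃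
  rw [← hv] at hpull
  set ρ : (Fin 2 → ℝ) → ℝ := fun p => Real.sqrt (f p) * v p with hρ
  have hρsm : ContDiff ℝ ∞ ρ := (hf.sqrt fun p => (hf_pos p).ne').mul hvsm
  have hρd : Differentiable ℝ ρ := hρsm.differentiable (by simp)
  have hρpos : ∀ p, 0 < ρ p := fun p => mul_pos (Real.sqrt_pos.2 (hf_pos p)) (hupos _)
  have hρ0 : ∀ p, ρ p ≠ 0 := fun p => (hρpos p).ne'
  have hρsq : ∀ p, ρ p ^ 2 = f p * v p ^ 2 := fun p => by
    rw [hρ, mul_pow, Real.sq_sqrt (hf_pos p).le]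
  have hg : gbar = rescaleMetric ρ (euclideanMetric 2) := by
    rw [hgbar, hpull]
    funext p
    simp [rescaleMetric, smul_smul, hρsq, mul_comm]
  have hmcv : ∀ p, meanCurvatureVector (rescaleMetric u (euclideanMetric 3)) (planeMap a₃) p =
      pd 2 u (planeMap a₃ p) • u (planeMap a₃ p) • Pi.single 2 1 := by
    intro p
    -- For the induced metric, where `ρ = v`, the tension field is twice the mean curvature vector.
    have := tension_planeMap (a := a₃) hud hu0 hvd hv0 p
    rw [meanCurvatureVector, hpull]
    simp only [tension] at this
    rw [this]
    have hp := hu0 (planeMap a₃ p)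
    funext k
    fin_cases k <;> simp [hv]
    field_simp
  refine ⟨⟨?_, isRiemannian_rescaleMetric_euclidean husm hupos, contDiff_planeMap a₃, ?_,
    fun p => Real.sqrt_pos.2 (hf_pos p), ?_⟩, ?_, ⟨?_, ?_, ?_⟩, ?_, hmcv⟩
  · rw [hg]
    exact isRiemannian_rescaleMetric_euclidean hρsm hρpos
  · intro x p q hpq
    simp only [fderiv_planeMap_apply] at hpq
    have h1 := congrFun hpq 0
    have h2 := congrFun hpq 1
    funext i
    fin_cases i <;> simpa using ‹_›
  · intro p
    rw [hgbar, Real.sq_sqrt (hf_pos p).le, smul_smul, mul_inv_cancel₀ (hf_pos p).ne', one_smul]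
  · rw [hg]
    set S : (Fin 2 → ℝ) → ℝ := fun p => 2 * f p * pd 2 u (planeMap a₃ p) with hS
    have hSsm : ContDiff ℝ ∞ S :=
      (contDiff_const.mul hf).mul ((contDiff_pd 2 husm).comp (contDiff_planeMap a₃))
    have hSd : Differentiable ℝ S := hSsm.differentiable (by simp)
    have hτ : tension (rescaleMetric ρ (euclideanMetric 2))
        (rescaleMetric u (euclideanMetric 3)) (planeMap a₃) =
          fun x => ![0, 0, S x * u (planeMap a₃ x)] := by
      funext x
      rw [tension_planeMap hud hu0 hρd hρ0, hρsq]
      have hp := hu0 (planeMap a₃ x)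
      congr 3
      simp only [hS, hv]
      field_simp
    have hbi := bitension_planeMap husm hu0 hρd hρ0 hSsm hτ
    have hplane : ∀ q : Fin 3 → ℝ, q 2 = a₃ → planeMap a₃ ![q 0, q 1] = q := by
      intro q hq
      funext k
      fin_cases k <;> simp [planeMap, hq]
    have hSS : ∀ i p, pd i (fun y => S y * S y) p = 2 * (S p * pd i S p) := fun i p => by
      rw [pd_mul i (hSd p) (hSd p)]; ring
    constructor
    · rintro ⟨⟨-, hbi0⟩, hharm⟩
      have hcomp : ∀ p k, _ := fun p k => congrFun ((smul_eq_zero_iff_right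
        (pow_ne_zero 2 (hρ0 p))).1 ((hbi p).symm.trans (hbi0 p))) k
      have hgrad : ∀ (i : Fin 2) p, S p * pd i S p = 0 := by
        intro i p
        have key : pd i S p * pd 2 u (planeMap a₃ p) = 0 := by
          fin_cases i
          · simpa using hcomp p 0
          · simpa using hcomp p 1
        rw [hS] at key ⊢
        linear_combination 2 * f p * key
      -- Only `S²` is available here: `S` may still have zeros, where its gradient is not yet
      -- controlled.
      have hconst : ∀ p q, S p * S p = S q * S q :=
        eq_of_pd_eq_zero (hSd.mul hSd) fun i p => by rw [← mul_zero 2, ← hgrad i p]; exact hSS i p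
      obtain ⟨p₀, hp₀⟩ : ∃ p, S p ≠ 0 := by
        by_contra! hall
        refine hharm ⟨contDiff_planeMap a₃, fun x => ?_⟩
        rw [hτ]
        funext k
        fin_cases k <;> simp [hall x]
      have hSne : ∀ p, S p ≠ 0 := fun p hp => hp₀ (by
        have := hconst p₀ p
        rw [hp] at this
        simpa using this)
      have hpd : ∀ i, pd i S = fun _ => 0 := fun i => by
        funext p
        exact (mul_eq_zero.1 (hgrad i p)).resolve_left (hSne p)
      have huz : ∀ p, pd 2 u (planeMap a₃ p) ≠ 0 := fun p hp => hSne p (by simp [hS, hp])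
      -- The constant comes from `|S| = 2 f |u_z|`.
      refine ⟨fun q hq => ?_, |S p₀| / 2, by positivity, fun p => ⟨huz p, ?_⟩⟩
      · have := hcomp ![q 0, q 1] 2
        simpa [hpd, pd_const, hplane q hq, hSne, hu0] using this
      · have habs : |S p₀| = |S p| := by
          rw [← Real.sqrt_mul_self_eq_abs, ← Real.sqrt_mul_self_eq_abs, hconst p₀ p]
        rw [habs, hS, abs_mul, abs_of_pos (mul_pos two_pos (hf_pos p))]
        have := abs_pos.2 (huz p)
        field_simp
    · rintro ⟨hP, c, hc, hfc⟩
      have hSq : ∀ p, S p * S p = 4 * c ^ 2 := by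
        intro p
        have hz := abs_pos.2 (hfc p).1
        have h1 : f p * |pd 2 u (planeMap a₃ p)| = c := by
          rw [(hfc p).2, div_mul_cancel₀ _ hz.ne']
        rw [← h1, mul_pow, sq_abs]
        simp only [hS]
        ring
      have hSne : ∀ p, S p ≠ 0 := fun p hp => by
        have := hSq p
        rw [hp] at this
        exact (by positivity : (4 : ℝ) * c ^ 2 ≠ 0) (by linarith)
      -- Differentiating `S² = 4c²` avoids arguing that `u_z` has constant sign.
      have hpd : ∀ i, pd i S = fun _ => 0 := fun i => by
        funext p
        have h1 := hSS i p
        simp only [hSq, pd_const] at h1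
        simpa [hSne p] using h1.symm
      refine ⟨⟨contDiff_planeMap a₃, fun p => ?_⟩, fun hharm => ?_⟩
      · have hPp := hP (planeMap a₃ p) rfl
        rw [hbi]
        simp only [hPp, hpd, pd_const]
        funext k
        fin_cases k <;> simp
      · have := congrFun ((congrFun hτ 0).symm.trans (hharm.2 0)) 2
        simp [hSne, hu0] at this
  · exact hvsm.smul contDiff_const
  · intro p i
    rw [metricInner_rescaleMetric_euclidean]
    fin_cases i <;> simp [pushBasis_planeMap, Fin.sum_univ_three]
  · intro p
    have hp := hu0 (planeMap a₃ p)
    rw [metricInner_rescaleMetric_euclidean]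
    simp [Fin.sum_univ_three]
    field_simp
  · intro p
    have hp := hu0 (planeMap a₃ p)
    rw [meanCurvature, hmcv, metricInner_rescaleMetric_euclidean]
    simp [Fin.sum_univ_three]
    field_simp
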